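/- **Setting.** Let $G=(V_G,E_G)$ be a DAG and let $\mathrm{PA}(Y)$ denote the set of parents of $Y\in V_G$. A *box* over $G$ is the mechanism of a variable $Y\in V_G$ drawn with attached input wires $X_1\otimes\cdots\otimes X_k$, where $X_1,\dots,X_k\in\mathrm{PA}(Y)$; it is a generator $X_1\otimes\cdots\otimes X_k\to Y$. The parents of $Y$ not among $X_1,\dots,X_k$ are unattached stubs of the box and are not part of its domain. For a set $\Sigma_G$ of boxes over $G$ (for instance all boxes, or one box for each variable with all its parents attached), let $\mathsf{Syn}_G$ be the string diagram category on $\Sigma_G$: the free symmetric monoidal category with copying and discarding (a commutative comonoid on every object, compatible with the tensor product) whose objects are generated by $V_G$ and whose morphisms are generated by the boxes in $\Sigma_G$ and one *intervened state* $\hat x: I\to X$ for every $X\in V_G$. Let $\mathsf{Stoch}$ be the category of finite sets and stochastic matrices. A *causal model* on $G$ is a functor $F_G:\mathsf{Syn}_G\to\mathsf{Stoch}$. For $\boldsymbol X\subset V_G$, the *intervention* $\mathsf{cut}_{\boldsymbol X}:\mathsf{Syn}_G\to\mathsf{Syn}_G$ is the endofunctor that is the identity on objects, replaces every box of a variable $X\in\boldsymbol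 X$ by the intervened state $\hat x$ (discarding the incoming wires), and leaves everything else intact. Let $\phi:G\to H$ be a homomorphism of DAGs, i.e. a map $\phi:V_G\to V_H$ such that $X\to Y\in E_G$ implies $\phi(X)\to\phi(Y)\in E_H$. It sends the box of $Y$ with wires $X_1,\dots,X_k$ to the box of $\phi(Y)$ with wires $\phi(X_1),\dots,\phi(X_k)$ and stubs $\mathrm{PA}(\phi(Y))\setminus\{\phi(X_1),\dots,\phi(X_k)\}$. Let $\Sigma_G,\Sigma_H$ be sets of boxes over $G$ and $H$ such that $\phi$ sends boxes in $\Sigma_G$ to boxes in $\Sigma_H$ (no condition if $\Sigma_H$ consists of all boxes), and let $\Phi:\mathsf{Syn}_G\to\mathsf{Syn}_H$ be the induced functor, which relabels strings by $\phi$, acts on boxes in this way, preserves the symmetric monoidal and copy/discard structure, and sends the intervened state of $X$ to that of $\phi(X)$. For $\boldsymbol X'\subset V_H$ put $\phi^*(\mathsf{cut}_{\boldsymbol X'})=\mathsf{cut}_{\phi^{-1}(\boldsymbol X')}$. **Theorem.** Let $F_G:\mathsf{Syn}_G\to\mathsf{Stoch}$ and $F_H:\mathsf{Syn}_H\to\mathsf{Stoch}$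 be causal models such that $F_H$ is a $\Phi$-abstraction of $F_G$, i.e. there is a natural transformation $\alpha:F_G\Rightarrow F_H\Phi$. Then for every $\boldsymbol X'\subset V_H$ there is a natural transformation $$F_G\cdot\phi^*(\mathsf{cut}_{\boldsymbol X'})\;\Rightarrow\;F_H\cdot\mathsf{cut}_{\boldsymbol X'}\cdot\Phi .$$ -/

import Mathlib

open CategoryTheory

universe u v w

/-- A directed acyclic graph on the vertex set `V`; `Adj X Y` is the edge `X → Y`. -/
structure CausalDAG (V : Type u) extends Digraph V where
  acyclic : ∀ X, ¬ Relation.TransGen Adj X X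

/-- `PA(Y)`, the set of parents of `Y`. -/
def CausalDAG.parents {V : Type u} (G : CausalDAG V) (Y : V) : Set V := {X | G.Adj X Y}

/-- A graph homomorphism `φ : G → H`. -/
structure CausalDAG.Hom {V : Type u} {W : Type v} (G : CausalDAG V) (H : CausalDAG W) where
  toFun : V → W
  map_adj : ∀ {X Y : V}, G.Adj X Y → H.Adj (toFun X) (toFun Y)

/-- The objects generated by the vertices: formal tensor products of vertices (parallel strings).
-/
inductive Wires (V : Type u) : Type u
  | of : V → Wires V
  | unit : Wires V
  | tensor : Wires V → Wires V → Wires V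

namespace Wires

/-- The vertices labelling the strings of an object. -/
def labels {V : Type u} : Wires V → Set V
  | of X => {X}
  | unit => ∅
  | tensor A B => labels A ∪ labels B

/-- Relabelling of strings along a map of vertices. -/
def map {V : Type u} {W : Type v} (f : V → W) : Wires V → Wires W
  | of X => of (f X)
  | unit => unit
  | tensor A B => tensor (map f A) (map f B)

theorem labels_map {V : Type u} {W : Type v} (f : V → W) (A : Wires V) :
    (A.map f).labels = f '' A.labels := by
  induction A with
  | of X => simp [map, labels]
  | unit => simp [map, labels]
  | tensor A B hA hB => simp [map, labels, hA, hB, Set.image_union]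

end Wires

/-- A box over `G`: the mechanism of the variable `out`, drawn with the wires
`X₁ ⊗ ⋯ ⊗ X_k = inputs` attached to it, where `X₁, …, X_k ∈ PA(out)`. The parents of `out` that
are not among the attached wires are the stubs `Z₁, …, Z_l` of the drawing; they are not part of
the domain of the box. The box in which all parents are attached has no stubs. -/
structure Box {V : Type u} (G : CausalDAG V) where
  out : V
  inputs : Wires V
  stubs : Set V
  inputs_subset : inputs.labels ⊆ G.parents out
  stubs_eq : stubs = G.parents out \ inputs.labels

/-- The action of a graph homomorphism on boxes. The box of `Y` with wires `X₁, …, X_k` is sent to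
the box of `φ(Y)` with wires `φ(X₁), …, φ(X_k)` and with stubs
`PA(φ(Y)) \ {φ(X₁), …, φ(X_k)}`. -/
def CausalDAG.Hom.mapBox {V : Type u} {W : Type v} {G : CausalDAG V} {H : CausalDAG W}
    (φ : G.Hom H) (b : Box G) : Box H where
  out := φ.toFun b.out
  inputs := b.inputs.map φ.toFun
  stubs := H.parents (φ.toFun b.out) \ φ.toFun '' b.inputs.labels
  inputs_subset := by
    rw [Wires.labels_map]
    rintro _ ⟨X, hX, rfl⟩
    exact φ.map_adj (b.inputs_subset hX)
  stubs_eq := by rw [Wires.labels_map]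

/-- String diagrams generated by a set `S` of boxes over `G` and by the intervened states
`x̂ : I → X`, using composition, tensor, symmetry, copying and discarding. -/
inductive Diagram {V : Type u} {G : CausalDAG V} (S : Set (Box G)) : Wires V → Wires V → Type u
  | box (b : Box G) (hb : b ∈ S) : Diagram S b.inputs (.of b.out)
  | hat (X : V) : Diagram S .unit (.of X)
  | id (A : Wires V) : Diagram S A A
  | comp {A B C : Wires V} (f : Diagram S A B) (g : Diagram S B C) : Diagram S A C
  | tensor {A B C D : Wires V} (f : Diagram S A B) (g : Diagram S C D) :
      Diagram S (.tensor A C) (.tensor B D)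
  | assoc (A B C : Wires V) : Diagram S (.tensor (.tensor A B) C) (.tensor A (.tensor B C))
  | assocInv (A B C : Wires V) : Diagram S (.tensor A (.tensor B C)) (.tensor (.tensor A B) C)
  | lunit (A : Wires V) : Diagram S (.tensor .unit A) A
  | lunitInv (A : Wires V) : Diagram S A (.tensor .unit A)
  | runit (A : Wires V) : Diagram S (.tensor A .unit) A
  | runitInv (A : Wires V) : Diagram S A (.tensor A .unit)
  | swap (A B : Wires V) : Diagram S (.tensor A B) (.tensor B A)
  | copy (A : Wires V) : Diagram S A (.tensor A A)
  | discard (A : Wires V) : Diagram S A .unit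

namespace Diagram

/-- The exchange `(A ⊗ B) ⊗ (C ⊗ D) → (A ⊗ C) ⊗ (B ⊗ D)` of the two middle wires. -/
def exchange {V : Type u} {G : CausalDAG V} (S : Set (Box G)) (A B C D : Wires V) :
    Diagram S (.tensor (.tensor A B) (.tensor C D)) (.tensor (.tensor A C) (.tensor B D)) :=
  (assoc A B (.tensor C D)).comp
    ((tensor (id A) (assocInv B C D)).comp
      ((tensor (id A) (tensor (swap B C) (id D))).comp
        ((tensor (id A) (assoc C B D)).comp (assocInv A C (.tensor B D)))))

/-- Equality of string diagrams: the congruence generated by the axioms of a symmetric monoidal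
category in which every object carries a commutative comonoid (copy, discard), compatibly with the
tensor product. No relations are imposed on the boxes and the intervened states. -/
inductive Rel {V : Type u} {G : CausalDAG V} {S : Set (Box G)} :
    ∀ {A B : Wires V}, Diagram S A B → Diagram S A B → Prop
  | id_comp {A B : Wires V} (f : Diagram S A B) : Rel ((id A).comp f) f
  | comp_id {A B : Wires V} (f : Diagram S A B) : Rel (f.comp (id B)) f
  | comp_assoc {A B C D : Wires V} (f : Diagram S A B) (g : Diagram S B C) (h : Diagram S C D) :
      Rel ((f.comp g).comp h) (f.comp (g.comp h))
  | tensor_id (A B : Wires V) : Rel ((id A).tensor (id B)) (id (.tensor A B))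
  | tensor_comp {A B C A' B' C' : Wires V} (f : Diagram S A B) (g : Diagram S B C)
      (f' : Diagram S A' B') (g' : Diagram S B' C') :
      Rel ((f.tensor f').comp (g.tensor g')) ((f.comp g).tensor (f'.comp g'))
  | assoc_hom_inv (A B C : Wires V) :
      Rel ((assoc A B C).comp (assocInv A B C)) (id _)
  | assoc_inv_hom (A B C : Wires V) :
      Rel ((assocInv A B C).comp (assoc A B C)) (id _)
  | assoc_natural {A B C A' B' C' : Wires V} (f : Diagram S A A') (g : Diagram S B B')
      (h : Diagram S C C') :
      Rel (((f.tensor g).tensor h).comp (assoc A' B' C'))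
        ((assoc A B C).comp (f.tensor (g.tensor h)))
  | lunit_hom_inv (A : Wires V) : Rel ((lunit A).comp (lunitInv A)) (id _)
  | lunit_inv_hom (A : Wires V) : Rel ((lunitInv A).comp (lunit A)) (id _)
  | lunit_natural {A B : Wires V} (f : Diagram S A B) :
      Rel (((id .unit).tensor f).comp (lunit B)) ((lunit A).comp f)
  | runit_hom_inv (A : Wires V) : Rel ((runit A).comp (runitInv A)) (id _)
  | runit_inv_hom (A : Wires V) : Rel ((runitInv A).comp (runit A)) (id _)
  | runit_natural {A B : Wires V} (f : Diagram S A B) :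
      Rel ((f.tensor (id .unit)).comp (runit B)) ((runit A).comp f)
  | pentagon (A B C D : Wires V) :
      Rel (((assoc A B C).tensor (id D)).comp
          ((assoc A (.tensor B C) D).comp ((id A).tensor (assoc B C D))))
        ((assoc (.tensor A B) C D).comp (assoc A B (.tensor C D)))
  | triangle (A B : Wires V) :
      Rel ((assoc A .unit B).comp ((id A).tensor (lunit B))) ((runit A).tensor (id B))
  | swap_swap (A B : Wires V) : Rel ((swap A B).comp (swap B A)) (id _)
  | swap_natural {A B A' B' : Wires V} (f : Diagram S A A') (g : Diagram S B B') :
      Rel ((f.tensor g).comp (swap A' B')) ((swap A B).comp (g.tensor f))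
  | hexagon (A B C : Wires V) :
      Rel ((assoc A B C).comp ((swap A (.tensor B C)).comp (assoc B C A)))
        (((swap A B).tensor (id C)).comp ((assoc B A C).comp ((id B).tensor (swap A C))))
  | copy_discard_left (A : Wires V) :
      Rel ((copy A).comp ((discard A).tensor (id A))) (lunitInv A)
  | copy_discard_right (A : Wires V) :
      Rel ((copy A).comp ((id A).tensor (discard A))) (runitInv A)
  | copy_assoc (A : Wires V) :
      Rel ((copy A).comp ((id A).tensor (copy A)))
        ((copy A).comp (((copy A).tensor (id A)).comp (assoc A A A)))
  | copy_swap (A : Wires V) : Rel ((copy A).comp (swap A A)) (copy A)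
  | copy_tensor (A B : Wires V) :
      Rel (copy (.tensor A B)) (((copy A).tensor (copy B)).comp (exchange S A A B B))
  | discard_tensor (A B : Wires V) :
      Rel (discard (.tensor A B)) (((discard A).tensor (discard B)).comp (lunit .unit))
  | copy_unit : Rel (copy .unit) (lunitInv .unit)
  | discard_unit : Rel (discard .unit) (id .unit)
  | comp {A B C : Wires V} {f f' : Diagram S A B} {g g' : Diagram S B C} :
      Rel f f' → Rel g g' → Rel (f.comp g) (f'.comp g')
  | tensor {A B C D : Wires V} {f f' : Diagram S A B} {g g' : Diagram S C D} :
      Rel f f' → Rel g g' → Rel (f.tensor g) (f'.tensor g')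
  | refl {A B : Wires V} (f : Diagram S A B) : Rel f f
  | symm {A B : Wires V} {f g : Diagram S A B} : Rel f g → Rel g f
  | trans {A B : Wires V} {f g h : Diagram S A B} : Rel f g → Rel g h → Rel f h

instance setoid {V : Type u} {G : CausalDAG V} (S : Set (Box G)) (A B : Wires V) :
    Setoid (Diagram S A B) :=
  ⟨Rel, Rel.refl, Rel.symm, Rel.trans⟩

/-- The image of a diagram under a graph homomorphism: strings are relabelled by `φ`, each box is
replaced by its image, and the intervened state of `X` by that of `φ(X)`. -/
def map {V : Type u} {W : Type v} {G : CausalDAG V} {H : CausalDAG W} (φ : G.Hom H)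
    {S : Set (Box G)} {T : Set (Box H)} (hφ : ∀ b ∈ S, φ.mapBox b ∈ T) :
    ∀ {A B : Wires V}, Diagram S A B → Diagram T (A.map φ.toFun) (B.map φ.toFun)
  | _, _, box b hb => box (φ.mapBox b) (hφ b hb)
  | _, _, hat X => hat (φ.toFun X)
  | _, _, id A => id (A.map φ.toFun)
  | _, _, comp f g => comp (map φ hφ f) (map φ hφ g)
  | _, _, tensor f g => tensor (map φ hφ f) (map φ hφ g)
  | _, _, assoc A B C => assoc (A.map φ.toFun) (B.map φ.toFun) (C.map φ.toFun)
  | _, _, assocInv A B C => assocInv (A.map φ.toFun) (B.map φ.toFun) (C.map φ.toFun)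
  | _, _, lunit A => lunit (A.map φ.toFun)
  | _, _, lunitInv A => lunitInv (A.map φ.toFun)
  | _, _, runit A => runit (A.map φ.toFun)
  | _, _, runitInv A => runitInv (A.map φ.toFun)
  | _, _, swap A B => swap (A.map φ.toFun) (B.map φ.toFun)
  | _, _, copy A => copy (A.map φ.toFun)
  | _, _, discard A => discard (A.map φ.toFun)

theorem map_rel {V : Type u} {W : Type v} {G : CausalDAG V} {H : CausalDAG W} (φ : G.Hom H)
    {S : Set (Box G)} {T : Set (Box H)} (hφ : ∀ b ∈ S, φ.mapBox b ∈ T)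
    {A B : Wires V} {f g : Diagram S A B} (h : Rel f g) : Rel (map φ hφ f) (map φ hφ g) := by
  induction h with
  | symm _ ih => exact ih.symm
  | trans _ _ ih ih' => exact ih.trans ih'
  | _ => constructor <;> assumption

open Classical in
/-- The surgery on diagrams intervening on the variables in `X`: the box of a variable in `X`
is replaced by the intervened state of that variable, the incoming wires being discarded; all
other boxes and strings are left intact. -/
noncomputable def cut {V : Type u} {G : CausalDAG V} {S : Set (Box G)} (X : Set V) :
    ∀ {A B : Wires V}, Diagram S A B → Diagram S A B
  | _, _, box b hb => if b.out ∈ X then (discard b.inputs).comp (hat b.out) else box b hb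
  | _, _, hat Y => hat Y
  | _, _, id A => id A
  | _, _, comp f g => comp (cut X f) (cut X g)
  | _, _, tensor f g => tensor (cut X f) (cut X g)
  | _, _, assoc A B C => assoc A B C
  | _, _, assocInv A B C => assocInv A B C
  | _, _, lunit A => lunit A
  | _, _, lunitInv A => lunitInv A
  | _, _, runit A => runit A
  | _, _, runitInv A => runitInv A
  | _, _, swap A B => swap A B
  | _, _, copy A => copy A
  | _, _, discard A => discard A

theorem cut_rel {V : Type u} {G : CausalDAG V} {S : Set (Box G)} (X : Set V)
    {A B : Wires V} {f g : Diagram S A B} (h : Rel f g) : Rel (cut X f) (cut X g) := by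
  induction h with
  | symm _ ih => exact ih.symm
  | trans _ _ ih ih' => exact ih.trans ih'
  | _ => constructor <;> assumption

end Diagram

/-- The string diagram category `Syn_G` on a set `S` of boxes over `G`: the free symmetric monoidal
category with copying and discarding, whose objects are generated by the vertices of `G` and whose
morphisms are generated by the boxes in `S` and the intervened states. -/
def Syn {V : Type u} {G : CausalDAG V} (_S : Set (Box G)) : Type u := Wires V

instance Syn.category {V : Type u} {G : CausalDAG V} (S : Set (Box G)) :
    Category.{u} (Syn S) where
  Hom A B := Quotient (Diagram.setoid S A B)
  id A := ⟦Diagram.id A⟧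
  comp := Quotient.map₂ Diagram.comp (fun _ _ hf _ _ hg => Diagram.Rel.comp hf hg)
  id_comp := by rintro A B ⟨f⟩; exact Quotient.sound (Diagram.Rel.id_comp f)
  comp_id := by rintro A B ⟨f⟩; exact Quotient.sound (Diagram.Rel.comp_id f)
  assoc := by
    rintro A B C D ⟨f⟩ ⟨g⟩ ⟨h⟩
    exact Quotient.sound (Diagram.Rel.comp_assoc f g h)

/-- The functor `Φ : Syn_G ⥤ Syn_H` induced by a graph homomorphism `φ : G → H`. -/
def graphFunctor {V : Type u} {W : Type v} {G : CausalDAG V} {H : CausalDAG W} (φ : G.Hom H)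
    {S : Set (Box G)} {T : Set (Box H)} (hφ : ∀ b ∈ S, φ.mapBox b ∈ T) : Syn S ⥤ Syn T where
  obj A := Wires.map φ.toFun A
  map := Quotient.map (Diagram.map φ hφ) (fun _ _ h => Diagram.map_rel φ hφ h)
  map_id _ := rfl
  map_comp := by rintro A B C ⟨f⟩ ⟨g⟩; rfl

/-- The intervention `cut_X : Syn_G ⥤ Syn_G` on a set `X` of variables. -/
noncomputable def cutFunctor {V : Type u} {G : CausalDAG V} (S : Set (Box G)) (X : Set V) :
    Syn S ⥤ Syn S where
  obj A := A
  map := Quotient.map (Diagram.cut X) (fun _ _ h => Diagram.cut_rel X h)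
  map_id _ := rfl
  map_comp := by rintro A B C ⟨f⟩ ⟨g⟩; rfl

/-- `φ^*(cut_{X'}) = cut_{φ⁻¹(X')}`, the micro-intervention obtained from the macro-intervention
on `X'`. -/
noncomputable def pullbackCut {V : Type u} {W : Type v} {G : CausalDAG V} {H : CausalDAG W}
    (φ : G.Hom H) (S : Set (Box G)) (X' : Set W) : Syn S ⥤ Syn S :=
  cutFunctor S (φ.toFun ⁻¹' X')

/-- The objects of `Stoch`: finite sets. -/
structure FinStoch : Type (w + 1) where
  carrier : Type w
  [fintype : Fintype carrier]

namespace FinStoch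

instance (X : FinStoch.{w}) : Fintype X.carrier := X.fintype

/-- Stochastic matrices from `X` to `Y`: the columns are indexed by `X`, the rows by `Y`, the
entries are nonnegative, and every column sums to `1`. -/
structure Hom (X Y : FinStoch.{w}) : Type w where
  matrix : Matrix Y.carrier X.carrier ℝ
  nonneg : ∀ y x, 0 ≤ matrix y x
  sum_col : ∀ x, ∑ y, matrix y x = 1

@[ext]
theorem Hom.ext' {X Y : FinStoch.{w}} {f g : Hom X Y} (h : f.matrix = g.matrix) : f = g := by
  cases f; cases g; cases h; rfl

open Classical in
/-- The category `Stoch` of finite sets and stochastic matrices, with matrix multiplication as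
composition. -/
noncomputable instance : Category.{w} FinStoch.{w} where
  Hom := Hom
  id X :=
    { matrix := 1
      nonneg := fun y x => by
        rw [Matrix.one_apply]; split <;> norm_num
      sum_col := fun x => by simp [Matrix.one_apply] }
  comp f g :=
    { matrix := g.matrix * f.matrix
      nonneg := fun y x => by
        rw [Matrix.mul_apply]
        exact Finset.sum_nonneg fun z _ => mul_nonneg (g.nonneg y z) (f.nonneg z x)
      sum_col := fun x => by
        simp only [Matrix.mul_apply]
        rw [Finset.sum_comm]
        simp only [← Finset.sum_mul, g.sum_col, one_mul, f.sum_col] }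
  id_comp f := Hom.ext' (Matrix.mul_one _)
  comp_id f := Hom.ext' (Matrix.one_mul _)
  assoc f g h := Hom.ext' (Matrix.mul_assoc _ _ _).symm

end FinStoch

/-- A causal model: a functor `Syn_G ⥤ Stoch`. -/
abbrev CausalModel {V : Type u} {G : CausalDAG V} (S : Set (Box G)) := Syn S ⥤ FinStoch.{w}

/-- `F_H` is a `Φ`-abstraction of `F_G`: there is a natural transformation `F_G ⇒ F_H Φ`. -/
def IsAbstraction {V : Type u} {W : Type v} {G : CausalDAG V} {H : CausalDAG W}
    {S : Set (Box G)} {T : Set (Box H)} (Φ : Syn S ⥤ Syn T)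
    (FG : CausalModel.{u, w} S) (FH : CausalModel.{v, w} T) : Prop :=
  Nonempty (FG ⟶ Φ ⋙ FH)

/-!
The induced functor `Φ` commutes with surgery: `Φ` sends the box of `Y` to the box of `φ(Y)`, so the
boxes replaced by `cut_{X'}` after applying `Φ` are exactly the images of the boxes of variables in
`φ⁻¹(X')`, and `Φ` preserves discarding and intervened states. Hence
`cut_{φ⁻¹(X')} ⋙ Φ = Φ ⋙ cut_{X'}` on the nose (`pullbackCut_comp_graphFunctor`), and whiskering the
abstraction `α : F_G ⟶ Φ ⋙ F_H` with `cut_{φ⁻¹(X')}` gives the required transformation.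
-/

/-- Surgery commutes with the action of a graph homomorphism, already before passing to
equivalence classes of diagrams. -/
theorem Diagram.map_cut {V : Type u} {W : Type v} {G : CausalDAG V} {H : CausalDAG W}
    (φ : G.Hom H) {S : Set (Box G)} {T : Set (Box H)} (hφ : ∀ b ∈ S, φ.mapBox b ∈ T)
    (X' : Set W) {A B : Wires V} (f : Diagram S A B) :
    map φ hφ (cut (φ.toFun ⁻¹' X') f) = cut X' (map φ hφ f) := by
  induction f with
  | box b hb =>
    by_cases h : φ.toFun b.out ∈ X'
    · have h' : b.out ∈ φ.toFun ⁻¹' X' := h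
      have h'' : (φ.mapBox b).out ∈ X' := h
      simp only [cut, map, if_pos h', if_pos h'']
      rfl
    · have h' : b.out ∉ φ.toFun ⁻¹' X' := h
      have h'' : (φ.mapBox b).out ∉ X' := h
      simp only [cut, map, if_neg h', if_neg h'']
      rfl
  | comp f g hf hg => simp only [cut, map, hf, hg]
  | tensor f g hf hg =>
    simp only [cut, map, hf, hg]
    rfl
  | _ => rfl

theorem pullbackCut_comp_graphFunctor {V : Type u} {W : Type v} {G : CausalDAG V}
    {H : CausalDAG W} (φ : G.Hom H) (S : Set (Box G)) (T : Set (Box H))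
    (hφ : ∀ b ∈ S, φ.mapBox b ∈ T) (X' : Set W) :
    pullbackCut φ S X' ⋙ graphFunctor φ hφ = graphFunctor φ hφ ⋙ cutFunctor T X' := by
  refine Functor.hext (fun _ => rfl) ?_
  rintro A B ⟨f⟩
  exact heq_of_eq (congrArg (Quotient.mk _) (Diagram.map_cut φ hφ X' f))

theorem theorem4 {V : Type u} {W : Type v} {G : CausalDAG V} {H : CausalDAG W} (φ : G.Hom H)
    (S : Set (Box G)) (T : Set (Box H)) (hφ : ∀ b ∈ S, φ.mapBox b ∈ T)
    (FG : CausalModel.{u, w} S) (FH : CausalModel.{v, w} T)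
    (habs : IsAbstraction (graphFunctor φ hφ) FG FH) (X' : Set W) :
    Nonempty (pullbackCut φ S X' ⋙ FG ⟶ graphFunctor φ hφ ⋙ cutFunctor T X' ⋙ FH) := by
  obtain ⟨α⟩ := habs
  exact ⟨Functor.whiskerLeft (pullbackCut φ S X') α ≫
    eqToHom (congrArg (· ⋙ FH) (pullbackCut_comp_graphFunctor φ S T hφ X'))⟩
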